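/- Let $\mathbb K$ be an algebraically closed field of characteristic zero, let $d\ge 3$ be an integer, and let $V$ be a vector space over $\mathbb K$ of dimension $d+1$ (so of finite dimension at least $4$). Definitions. A square matrix $B$ with rows and columns indexed by $0,\dots,d$ is tridiagonal if each nonzero entry lies on the diagonal, the subdiagonal or the superdiagonal; a tridiagonal $B$ is irreducible if all its subdiagonal and superdiagonal entries are nonzero, bipartite if $B_{ii}=0$ for $0\le i\le d$, and almost bipartite if exactly one of $B_{00},B_{dd}$ is nonzero and $B_{ii}=0$ for $1\le i\le d-1$. A Leonard triple on $V$ is an ordered triple $A,A^*,A^\varepsilon$ of linear maps $V\to V$ such that for each of the three maps there is a basis of $V$ with respect to which that map is represented by a diagonal matrix and the other two by irreducible tridiagonal matrices. It is totally bipartite (resp. totally almost bipartite) if all six of these tridiagonal matrices are bipartite (resp. almost bipartite), and totally B/AB if it is totally bipartite or totally almost bipartite. A Leonard triple is of Bannai/Ito type if, for a basis $v_0,\dots,v_d$ with respect to which $A$ is diagonal and $A^*,A^\varepsilon$ are irreducible tridiagonal, the eigenvalues given by $Av_i=\theta_iv_i$ satisfy $(\theta_{i-2}-\theta_{i+1})/(\theta_{i-1}-\theta_i)=-1$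 for $2\le i\le d-1$. (These conditions do not depend on the choice of the bases.) A totally B/AB Leonard triple $A,A^*,A^\varepsilon$ of Bannai/Ito type is normalized if $$AA^*+A^*A=2A^\varepsilon,\qquad A^*A^\varepsilon+A^\varepsilon A^*=2A,\qquad A^\varepsilon A+AA^\varepsilon=2A^*.$$ Two triples $A,A^*,A^\varepsilon$ on $V$ and $B,B^*,B^\varepsilon$ on $W$ are isomorphic if there is a linear bijection $\varphi:V\to W$ with $\varphi A=B\varphi$, $\varphi A^*=B^*\varphi$ and $\varphi A^\varepsilon=B^\varepsilon\varphi$. Proposition. Let $A,A^*,A^\varepsilon$ be a totally B/AB Leonard triple on $V$ of Bannai/Ito type. Then there exist exactly four sequences $(\xi,\xi^*,\xi^\varepsilon)$ of nonzero scalars in $\mathbb K$ such that $\xi A,\xi^*A^*,\xi^\varepsilon A^\varepsilon$ is a normalized totally B/AB Leonard triple of Bannai/Ito type. If $A,A^*,A^\varepsilon$ is totally bipartite, then the four resulting normalized Leonard triples are isomorphic to one another. If $A,A^*,A^\varepsilon$ is totally almost bipartite, then the four resulting normalized Leonard triples are mutually nonisomorphic. -/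

import Mathlib

namespace LeonardTriple

open Module

/-! Matrices are indexed by `0, 1, …, d`. -/

section Matrices

variable {K : Type*} [Field K] {d : ℕ}

/-- Every nonzero entry lies on the diagonal, the superdiagonal or the subdiagonal. -/
def IsTridiagonal (B : Matrix (Fin (d + 1)) (Fin (d + 1)) K) : Prop :=
  ∀ i j, B i j ≠ 0 → (i : ℕ) = j ∨ (i : ℕ) + 1 = j ∨ (j : ℕ) + 1 = i

/-- A tridiagonal matrix all of whose superdiagonal and subdiagonal entries are nonzero. -/
def IsIrreducibleTridiagonal (B : Matrix (Fin (d + 1)) (Fin (d + 1)) K) : Prop :=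
  IsTridiagonal B ∧ ∀ i j : Fin (d + 1), (i : ℕ) + 1 = j → B i j ≠ 0 ∧ B j i ≠ 0

/-- A tridiagonal matrix with zero diagonal. -/
def IsBipartite (B : Matrix (Fin (d + 1)) (Fin (d + 1)) K) : Prop :=
  IsTridiagonal B ∧ ∀ i, B i i = 0

/-- A tridiagonal matrix for which exactly one of the corner entries `B 0 0`, `B d d` is nonzero,
and whose other diagonal entries are zero. -/
def IsAlmostBipartite (B : Matrix (Fin (d + 1)) (Fin (d + 1)) K) : Prop :=
  IsTridiagonal B ∧
    Xor (B 0 0 ≠ 0) (B (Fin.last d) (Fin.last d) ≠ 0) ∧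
    ∀ i : Fin (d + 1), 1 ≤ (i : ℕ) → (i : ℕ) + 1 ≤ d → B i i = 0

end Matrices

section Triples

variable {K V : Type*} [Field K] [AddCommGroup V] [Module K V]

/-- With respect to the basis `b`, the map `A` is diagonal and `As`, `Ae` are
irreducible tridiagonal. -/
def IsStandardBasis {d : ℕ} (b : Basis (Fin (d + 1)) K V) (A As Ae : End K V) : Prop :=
  (LinearMap.toMatrix b b A).IsDiag ∧
    IsIrreducibleTridiagonal (LinearMap.toMatrix b b As) ∧
    IsIrreducibleTridiagonal (LinearMap.toMatrix b b Ae)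

/-- `A, As, Ae` is a Leonard triple of diameter `d` on `V` (so `V` has dimension `d + 1`). -/
def IsLeonardTriple (d : ℕ) (A As Ae : End K V) : Prop :=
  (∃ b : Basis (Fin (d + 1)) K V, IsStandardBasis b A As Ae) ∧
    (∃ b : Basis (Fin (d + 1)) K V, IsStandardBasis b As Ae A) ∧
    (∃ b : Basis (Fin (d + 1)) K V, IsStandardBasis b Ae A As)

/-- A Leonard triple all of whose six tridiagonal matrices are bipartite. -/
def IsTotallyBipartite (d : ℕ) (A As Ae : End K V) : Prop :=
  IsLeonardTriple d A As Ae ∧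
    (∀ b : Basis (Fin (d + 1)) K V, IsStandardBasis b A As Ae →
      IsBipartite (LinearMap.toMatrix b b As) ∧ IsBipartite (LinearMap.toMatrix b b Ae)) ∧
    (∀ b : Basis (Fin (d + 1)) K V, IsStandardBasis b As Ae A →
      IsBipartite (LinearMap.toMatrix b b Ae) ∧ IsBipartite (LinearMap.toMatrix b b A)) ∧
    (∀ b : Basis (Fin (d + 1)) K V, IsStandardBasis b Ae A As →
      IsBipartite (LinearMap.toMatrix b b A) ∧ IsBipartite (LinearMap.toMatrix b b As))

/-- A Leonard triple all of whose six tridiagonal matrices are almost bipartite. -/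
def IsTotallyAlmostBipartite (d : ℕ) (A As Ae : End K V) : Prop :=
  IsLeonardTriple d A As Ae ∧
    (∀ b : Basis (Fin (d + 1)) K V, IsStandardBasis b A As Ae →
      IsAlmostBipartite (LinearMap.toMatrix b b As) ∧
        IsAlmostBipartite (LinearMap.toMatrix b b Ae)) ∧
    (∀ b : Basis (Fin (d + 1)) K V, IsStandardBasis b As Ae A →
      IsAlmostBipartite (LinearMap.toMatrix b b Ae) ∧
        IsAlmostBipartite (LinearMap.toMatrix b b A)) ∧
    (∀ b : Basis (Fin (d + 1)) K V, IsStandardBasis b Ae A As →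
      IsAlmostBipartite (LinearMap.toMatrix b b A) ∧
        IsAlmostBipartite (LinearMap.toMatrix b b As))

/-- Totally B/AB: totally bipartite or totally almost bipartite. -/
def IsTotallyBAB (d : ℕ) (A As Ae : End K V) : Prop :=
  IsTotallyBipartite d A As Ae ∨ IsTotallyAlmostBipartite d A As Ae

/-- A Leonard triple is of Bannai/Ito type when, for the eigenvalue `θ i` of `A` on the `i`-th
vector of a standard basis, `(θ (i-2) - θ (i+1)) / (θ (i-1) - θ i) = -1` for `2 ≤ i ≤ d - 1`. -/
def IsBannaiItoType (d : ℕ) (A As Ae : End K V) : Prop :=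
  IsLeonardTriple d A As Ae ∧
    ∀ b : Basis (Fin (d + 1)) K V, IsStandardBasis b A As Ae →
      ∀ θ : Fin (d + 1) → K, (∀ i, A (b i) = θ i • b i) →
        ∀ (i : ℕ) (_ : 2 ≤ i) (_ : i + 1 ≤ d),
          (θ ⟨i - 2, by omega⟩ - θ ⟨i + 1, by omega⟩) /
            (θ ⟨i - 1, by omega⟩ - θ ⟨i, by omega⟩) = -1

/-- A totally B/AB Leonard triple of Bannai/Ito type is normalized when the scalars in the
relations `A As + As A = νe Ae`, `As Ae + Ae As = ν A`, `Ae A + A Ae = νs As`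
are all equal to `2`. -/
def IsNormalized (d : ℕ) (A As Ae : End K V) : Prop :=
  IsTotallyBAB d A As Ae ∧ IsBannaiItoType d A As Ae ∧
    A * As + As * A = (2 : K) • Ae ∧
    As * Ae + Ae * As = (2 : K) • A ∧
    Ae * A + A * Ae = (2 : K) • As

/-- The triples `A, As, Ae` on `V` and `B, Bs, Be` on `W` are isomorphic: a linear bijection
`V → W` intertwines them. -/
def Isomorphic {W : Type*} [AddCommGroup W] [Module K W]
    (A As Ae : End K V) (B Bs Be : End K W) : Prop :=
  ∃ φ : V ≃ₗ[K] W,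
    (∀ v, φ (A v) = B (φ v)) ∧ (∀ v, φ (As v) = Bs (φ v)) ∧ (∀ v, φ (Ae v) = Be (φ v))

/-- The triples `(ξ, ξs, ξe)` of nonzero scalars for which the rescaled triple
`ξ A, ξs As, ξe Ae` is normalized. -/
def normalizingScalars (d : ℕ) (A As Ae : End K V) : Set (K × K × K) :=
  {ξ | ξ.1 ≠ 0 ∧ ξ.2.1 ≠ 0 ∧ ξ.2.2 ≠ 0 ∧
    IsNormalized d (ξ.1 • A) (ξ.2.1 • As) (ξ.2.2 • Ae)}

end Triples

end LeonardTriple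

/-! The heart of the matter is that each map is a nonzero multiple of the anticommutator of the
other two: `A As + As A = n₃ Ae`, and cyclically. Given this, rescaling by `(x, y, z)` normalizes
the triple exactly when `x y n₃ = 2 z`, `y z n₁ = 2 x`, `z x n₂ = 2 y`. These equations fix `x²` and
`y²`, and then `z` in terms of `x` and `y`, so there are four solutions, differing by an even number
of sign changes. In the bipartite case the reflection with signs `(-1)^i` in an eigenbasis of one
map negates the other two and so realizes each change of signs. In the almost bipartite case all
traces are nonzero, so an isomorphism forces equal scalars.

The anticommutator relations rest on a rigidity principle
(`eq_zero_of_isDiag_of_hasLowerBandwidth`): a map diagonal in an eigenbasis of `X` is a polynomial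
in `X`, whose degree is bounded by its bandwidth in a basis where `X` is irreducible tridiagonal;
enough zero eigenvalues then kill it. This yields cubic relations `X²Y + 2XYX + YX² = ρ Y` with `ρ ≠
0` for pairs from the triple (`exists_relation_of_recurrence`). In an eigenbasis of `A`, the
relations between `As` and `Ae` force the off-diagonal entries of `Ae` to be those of `As` times `β
(-1)^i`. Sums of neighbouring eigenvalues of `A` alternate in sign too, so `A As + As A` is
proportional to `Ae` off the diagonal, and rigidity removes the diagonal discrepancy. -/

namespace LeonardTriple

open Module Polynomial

/-! ### Band matrices and their extreme diagonals -/

section BandMatrices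

variable {K : Type*} [Field K] {d : ℕ}

/-- The entries more than `p` steps below the diagonal vanish. -/
def HasLowerBandwidth (p : ℕ) (B : Matrix (Fin (d + 1)) (Fin (d + 1)) K) : Prop :=
  ∀ i j : Fin (d + 1), (j : ℕ) + p < i → B i j = 0

theorem HasLowerBandwidth.mono {p q : ℕ} {B : Matrix (Fin (d + 1)) (Fin (d + 1)) K}
    (hB : HasLowerBandwidth p B) (hpq : p ≤ q) : HasLowerBandwidth q B :=
  fun i j h => hB i j (by omega)

theorem HasLowerBandwidth.mul {p q : ℕ} {B C : Matrix (Fin (d + 1)) (Fin (d + 1)) K}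
    (hB : HasLowerBandwidth p B) (hC : HasLowerBandwidth q C) :
    HasLowerBandwidth (p + q) (B * C) := by
  intro i j h
  rw [Matrix.mul_apply]
  refine Finset.sum_eq_zero fun k _ => ?_
  by_cases hk : (k : ℕ) + p < i
  · rw [hB i k hk, zero_mul]
  · rw [hC k j (by omega), mul_zero]

/-- A descent of `p + q` steps must use the full bandwidth of both factors, so only one intermediate
index contributes. -/
theorem HasLowerBandwidth.mul_apply {p q : ℕ} {B C : Matrix (Fin (d + 1)) (Fin (d + 1)) K}
    (hB : HasLowerBandwidth p B) (hC : HasLowerBandwidth q C) {i j k : Fin (d + 1)}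
    (hij : (i : ℕ) = j + p) (hjk : (j : ℕ) = k + q) : (B * C) i k = B i j * C j k := by
  rw [Matrix.mul_apply]
  refine Finset.sum_eq_single j (fun l _ hl => ?_) (by simp)
  have hl' : (l : ℕ) ≠ j := fun h => hl (Fin.ext h)
  by_cases h : (l : ℕ) + p < i
  · rw [hB i l h, zero_mul]
  · rw [hC l k (by omega), mul_zero]

theorem HasLowerBandwidth.add {p : ℕ} {B C : Matrix (Fin (d + 1)) (Fin (d + 1)) K}
    (hB : HasLowerBandwidth p B) (hC : HasLowerBandwidth p C) : HasLowerBandwidth p (B + C) :=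
  fun i j h => by rw [Matrix.add_apply, hB i j h, hC i j h, add_zero]

theorem HasLowerBandwidth.sub {p : ℕ} {B C : Matrix (Fin (d + 1)) (Fin (d + 1)) K}
    (hB : HasLowerBandwidth p B) (hC : HasLowerBandwidth p C) : HasLowerBandwidth p (B - C) :=
  fun i j h => by rw [Matrix.sub_apply, hB i j h, hC i j h, sub_zero]

theorem HasLowerBandwidth.smul {p : ℕ} {B : Matrix (Fin (d + 1)) (Fin (d + 1)) K}
    (hB : HasLowerBandwidth p B) (c : K) : HasLowerBandwidth p (c • B) :=
  fun i j h => by rw [Matrix.smul_apply, hB i j h, smul_zero]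

theorem hasLowerBandwidth_of_isDiag {B : Matrix (Fin (d + 1)) (Fin (d + 1)) K} (hB : B.IsDiag) :
    HasLowerBandwidth 0 B :=
  fun i j h => hB (fun e => by subst e; omega)

theorem IsTridiagonal.hasLowerBandwidth {B : Matrix (Fin (d + 1)) (Fin (d + 1)) K}
    (hB : IsTridiagonal B) : HasLowerBandwidth 1 B := by
  intro i j h
  by_contra h0
  have := hB i j h0
  omega

theorem IsTridiagonal.mul_apply_of_diag_eq_zero {B : Matrix (Fin (d + 1)) (Fin (d + 1)) K}
    (hB : IsTridiagonal B) {i j k : Fin (d + 1)} (hj : B j j = 0) (hij : (i : ℕ) + 1 = j)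
    (hjk : (j : ℕ) + 1 = k) (C : Matrix (Fin (d + 1)) (Fin (d + 1)) K) (x : Fin (d + 1)) :
    (B * C) j x = B j i * C i x + B j k * C k x := by
  rw [Matrix.mul_apply]
  refine Finset.sum_eq_add i k (fun h => ?_) (fun l _ hl => ?_) (by simp) (by simp)
  · subst h
    omega
  · by_cases h : B j l = 0
    · rw [h, zero_mul]
    · rcases hB j l h with h' | h' | h'
      · obtain rfl := Fin.ext h'
        exact absurd hj h
      · exact absurd (Fin.ext (by omega)) hl.2
      · exact absurd (Fin.ext (by omega)) hl.1

theorem IsTridiagonal.transpose {B : Matrix (Fin (d + 1)) (Fin (d + 1)) K}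
    (hB : IsTridiagonal B) : IsTridiagonal B.transpose := by
  intro i j h
  have := hB j i h
  omega

theorem IsTridiagonal.mul_apply_of_diag_eq_zero' {B : Matrix (Fin (d + 1)) (Fin (d + 1)) K}
    (hB : IsTridiagonal B) {i j k : Fin (d + 1)} (hj : B j j = 0) (hij : (i : ℕ) + 1 = j)
    (hjk : (j : ℕ) + 1 = k) (C : Matrix (Fin (d + 1)) (Fin (d + 1)) K) (x : Fin (d + 1)) :
    (C * B) x j = C x i * B i j + C x k * B k j := by
  rw [← Matrix.transpose_apply (C * B), Matrix.transpose_mul,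
    hB.transpose.mul_apply_of_diag_eq_zero hj hij hjk]
  simp only [Matrix.transpose_apply]
  ring

theorem IsIrreducibleTridiagonal.transpose {B : Matrix (Fin (d + 1)) (Fin (d + 1)) K}
    (hB : IsIrreducibleTridiagonal B) : IsIrreducibleTridiagonal B.transpose :=
  ⟨hB.1.transpose, fun i j h => (hB.2 i j h).symm⟩

theorem IsTridiagonal.hasLowerBandwidth_pow {B : Matrix (Fin (d + 1)) (Fin (d + 1)) K}
    (hB : IsTridiagonal B) (n : ℕ) : HasLowerBandwidth n (B ^ n) := by
  induction n with
  | zero =>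
    rw [pow_zero]
    exact hasLowerBandwidth_of_isDiag Matrix.isDiag_one
  | succ n ih =>
    rw [pow_succ]
    exact ih.mul hB.hasLowerBandwidth

theorem IsIrreducibleTridiagonal.pow_apply_zero_ne_zero
    {B : Matrix (Fin (d + 1)) (Fin (d + 1)) K} (hB : IsIrreducibleTridiagonal B) (n : ℕ)
    (i : Fin (d + 1)) (hi : (i : ℕ) = n) : (B ^ n) i 0 ≠ 0 := by
  induction n generalizing i with
  | zero =>
    obtain rfl : i = 0 := Fin.ext hi
    simp
  | succ n ih =>
    have hn : n < d + 1 := by omega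
    rw [pow_succ', hB.1.hasLowerBandwidth.mul_apply (hB.1.hasLowerBandwidth_pow n)
      (j := ⟨n, hn⟩) (by simp [hi]) (by simp)]
    exact mul_ne_zero (hB.2 ⟨n, hn⟩ i (by simp [hi])).2 (ih _ rfl)

/-- Only the leading power of `B` reaches that far below the diagonal, and its entry there is a
product of subdiagonal entries. Thus the degree of a polynomial in `B` can be read off the first
column. -/
theorem IsIrreducibleTridiagonal.aeval_apply_zero_ne_zero
    {B : Matrix (Fin (d + 1)) (Fin (d + 1)) K} (hB : IsIrreducibleTridiagonal B) {p : K[X]}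
    (hp : p ≠ 0) (i : Fin (d + 1)) (hi : (i : ℕ) = p.natDegree) : (aeval B p) i 0 ≠ 0 := by
  rw [aeval_eq_sum_range, Matrix.sum_apply, Finset.sum_range_succ, Finset.sum_eq_zero, zero_add]
  · rw [Matrix.smul_apply, smul_eq_mul]
    exact mul_ne_zero (leadingCoeff_ne_zero.mpr hp) (hB.pow_apply_zero_ne_zero _ i hi)
  · intro n hn
    rw [Finset.mem_range] at hn
    rw [Matrix.smul_apply, hB.1.hasLowerBandwidth_pow n i 0 (by simp; omega), smul_zero]

end BandMatrices

/-! ### Rigidity in eigenbases and the cubic relation -/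

section Eigenbases

variable {K V : Type*} [Field K] [AddCommGroup V] [Module K V] {d : ℕ}

theorem apply_basis_of_isDiag {v : Basis (Fin (d + 1)) K V} {X : End K V}
    (hX : (LinearMap.toMatrix v v X).IsDiag) (i : Fin (d + 1)) :
    X (v i) = LinearMap.toMatrix v v X i i • v i := by
  conv_lhs => rw [← v.sum_repr (X (v i))]
  rw [Finset.sum_eq_single i]
  · rw [LinearMap.toMatrix_apply]
  · intro j _ hj
    have : LinearMap.toMatrix v v X j i = 0 := hX hj
    rw [LinearMap.toMatrix_apply] at this
    rw [this, zero_smul]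
  · simp

theorem toMatrix_aeval (w : Basis (Fin (d + 1)) K V) (X : End K V) (p : K[X]) :
    LinearMap.toMatrix w w (aeval X p) = aeval (LinearMap.toMatrix w w X) p :=
  (aeval_algHom_apply (LinearMap.toMatrixAlgEquiv w).toAlgHom X p).symm

theorem aeval_apply_basis {v : Basis (Fin (d + 1)) K V} {X : End K V}
    (hX : (LinearMap.toMatrix v v X).IsDiag) (p : K[X]) (i : Fin (d + 1)) :
    aeval X p (v i) = p.eval (LinearMap.toMatrix v v X i i) • v i :=
  End.aeval_apply_of_hasEigenvector
    ⟨End.mem_eigenspace_iff.mpr (apply_basis_of_isDiag hX i), v.ne_zero i⟩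

theorem eq_zero_of_aeval_eq_zero {w : Basis (Fin (d + 1)) K V} {X : End K V}
    (hX : IsIrreducibleTridiagonal (LinearMap.toMatrix w w X)) {p : K[X]}
    (hp : p.natDegree ≤ d) (h : aeval X p = 0) : p = 0 := by
  by_contra h0
  refine hX.aeval_apply_zero_ne_zero h0 ⟨p.natDegree, by omega⟩ rfl ?_
  rw [← toMatrix_aeval, h]
  simp

/-- The eigenvalues of a diagonalizable map that is irreducible tridiagonal in some basis are
distinct. -/
theorem eigenvalue_injective {v w : Basis (Fin (d + 1)) K V} {X : End K V}
    (hv : (LinearMap.toMatrix v v X).IsDiag)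
    (hw : IsIrreducibleTridiagonal (LinearMap.toMatrix w w X)) :
    Function.Injective fun i => LinearMap.toMatrix v v X i i := by
  classical
  set θ := fun i => LinearMap.toMatrix v v X i i with hθ
  rw [← Set.injOn_univ, ← Finset.coe_univ, ← Finset.card_image_iff]
  refine le_antisymm Finset.card_image_le ?_
  by_contra hlt
  rw [not_le] at hlt
  simp only [Finset.card_univ, Fintype.card_fin] at hlt
  -- With a repeated eigenvalue, the product over the distinct ones would be a monic polynomial of
  -- degree at most `d` annihilating `X`.
  have hmonic := monic_prod_of_monic (Finset.univ.image θ) (fun a => Polynomial.X - C a)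
    fun a _ => monic_X_sub_C a
  refine hmonic.ne_zero (eq_zero_of_aeval_eq_zero (X := X) hw ?_ (v.ext fun i => ?_))
  · rw [natDegree_prod_of_monic _ _ fun a _ => monic_X_sub_C a]
    simp only [natDegree_X_sub_C, Finset.sum_const, smul_eq_mul, mul_one]
    omega
  · rw [aeval_apply_basis hv, eval_prod, Finset.prod_eq_zero (i := θ i), zero_smul,
      LinearMap.zero_apply]
    · simp
    · simp [hθ]

/-- A map that is diagonal in an eigenbasis of `X` with more than `m` zero eigenvalues, and of
bandwidth `m` in a basis in which `X` is irreducible tridiagonal, is zero. -/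
theorem eq_zero_of_isDiag_of_hasLowerBandwidth {v w : Basis (Fin (d + 1)) K V} {X M : End K V}
    (hv : (LinearMap.toMatrix v v X).IsDiag)
    (hw : IsIrreducibleTridiagonal (LinearMap.toMatrix w w X))
    (hM : (LinearMap.toMatrix v v M).IsDiag) {m : ℕ}
    (hMw : HasLowerBandwidth m (LinearMap.toMatrix w w M)) (s : Finset (Fin (d + 1)))
    (hs : m < s.card) (hs0 : ∀ i ∈ s, LinearMap.toMatrix v v M i i = 0) : M = 0 := by
  classical
  have hinj := eigenvalue_injective hv hw
  set θ := fun i => LinearMap.toMatrix v v X i i with hθ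
  -- Since the eigenvalues are distinct, interpolation writes `M` as `p(X)`. The bandwidth bounds
  -- the degree of `p` by `m`, while `p` has more than `m` roots.
  set p : K[X] := Lagrange.interpolate Finset.univ θ
    (fun i => LinearMap.toMatrix v v M i i) with hp
  have hev : ∀ i, p.eval (θ i) = LinearMap.toMatrix v v M i i := fun i =>
    Lagrange.eval_interpolate_at_node _ hinj.injOn (Finset.mem_univ i)
  have hpM : aeval X p = M := v.ext fun i => by
    rw [aeval_apply_basis hv, apply_basis_of_isDiag hM, ← hev]
  suffices h : p = 0 by rw [← hpM, h, map_zero]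
  by_contra h0
  have hdeg : p.natDegree < d + 1 := by
    have := Lagrange.degree_interpolate_lt (fun i => LinearMap.toMatrix v v M i i)
      (hinj.injOn (s := ↑(Finset.univ : Finset (Fin (d + 1)))))
    rw [Finset.card_univ, Fintype.card_fin] at this
    exact (natDegree_lt_iff_degree_lt h0).mpr this
  have hle : p.natDegree ≤ m := by
    by_contra hlt
    refine hw.aeval_apply_zero_ne_zero h0 ⟨p.natDegree, hdeg⟩ rfl ?_
    rw [← toMatrix_aeval, hpM]
    exact hMw _ _ (by simp; omega)
  refine h0 (eq_zero_of_natDegree_lt_card_of_eval_eq_zero' p (s.image θ) ?_ ?_)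
  · intro x hx
    obtain ⟨i, hi, rfl⟩ := Finset.mem_image.mp hx
    rw [hev, hs0 i hi]
  · rw [Finset.card_image_of_injective _ hinj]
    omega

/-- The quadratic relation satisfied by a pair of maps when the sums of neighbouring eigenvalues
of the first take two values only. -/
theorem anticommutator_relation {v w : Basis (Fin (d + 1)) K V} {X Y : End K V} (hd : 3 ≤ d)
    (hXv : (LinearMap.toMatrix v v X).IsDiag) (hYv : IsTridiagonal (LinearMap.toMatrix v v Y))
    (hYw : (LinearMap.toMatrix w w Y).IsDiag)
    (hXw : IsIrreducibleTridiagonal (LinearMap.toMatrix w w X))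
    (hc : ∃ c, ∀ i, i ≠ c → LinearMap.toMatrix v v Y i i = 0) (s t : K)
    (hst : ∀ i j : Fin (d + 1), (i : ℕ) + 1 = j →
      LinearMap.toMatrix v v X i i + LinearMap.toMatrix v v X j j = s ∨
      LinearMap.toMatrix v v X i i + LinearMap.toMatrix v v X j j = t) :
    X * (X * Y + Y * X) + (X * Y + Y * X) * X = (s + t) • (X * Y + Y * X) - (s * t) • Y := by
  classical
  obtain ⟨c, hc⟩ := hc
  rw [← sub_eq_zero]
  set M := X * (X * Y + Y * X) + (X * Y + Y * X) * X -
    ((s + t) • (X * Y + Y * X) - (s * t) • Y) with hMdef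
  -- The quadratic factor vanishes at neighbouring indices by the choice of `s` and `t`, so `M` is
  -- diagonal in `v`, with a nonzero entry at most at `c`.
  have hMv : ∀ i j, LinearMap.toMatrix v v M i j =
      ((LinearMap.toMatrix v v X i i + LinearMap.toMatrix v v X j j) - s) *
      ((LinearMap.toMatrix v v X i i + LinearMap.toMatrix v v X j j) - t) *
      LinearMap.toMatrix v v Y i j := by
    intro i j
    obtain ⟨D, hD⟩ : ∃ D, LinearMap.toMatrix v v X = Matrix.diagonal D :=
      ⟨_, hXv.diagonal_diag.symm⟩
    simp only [hMdef, map_sub, map_add, map_smul, LinearMap.toMatrix_mul, hD, Matrix.add_apply,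
      Matrix.sub_apply, Matrix.smul_apply, Matrix.diagonal_mul, Matrix.mul_diagonal, mul_add,
      add_mul, ← mul_assoc, Matrix.diagonal_apply_eq, smul_eq_mul]
    simp only [mul_assoc, Matrix.diagonal_mul]
    ring
  have hX1 := hXw.1.hasLowerBandwidth
  have hY0 := hasLowerBandwidth_of_isDiag hYw
  -- `M` is quadratic in `X` and linear in the diagonal `Y`, whence bandwidth 2 in `w`; the `d ≥ 3`
  -- indices other than `c` supply the zeros.
  refine eq_zero_of_isDiag_of_hasLowerBandwidth hXv hXw (m := 2) (M := M) ?_ ?_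
    (Finset.univ.erase c) ?_ ?_
  · intro i j hij
    rw [hMv]
    by_cases h : LinearMap.toMatrix v v Y i j = 0
    · rw [h, mul_zero]
    · rcases hYv i j h with h | h | h
      · exact absurd (Fin.ext h) hij
      · rcases hst i j h with h | h <;> simp [h]
      · rw [add_comm (LinearMap.toMatrix v v X i i)]
        rcases hst j i h with h | h <;> simp [h]
  · simp only [hMdef, map_sub, map_add, map_smul, LinearMap.toMatrix_mul]
    have h1 := (hX1.mul hY0).add ((hY0.mul hX1).mono (q := 1 + 0) le_rfl)
    exact ((hX1.mul h1).add ((h1.mul hX1).mono (by omega))).sub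
      (((h1.mono (by omega)).smul _).sub ((hY0.mono (by omega)).smul _))
  · rw [Finset.card_erase_of_mem (Finset.mem_univ c)]
    simp
    omega
  · intro i hi
    rw [hMv, hc i (Finset.ne_of_mem_erase hi), mul_zero]

/-- The entry of the relation two steps below the diagonal is the claimed sum times a product of two
subdiagonal entries of `X`; the right-hand side has bandwidth 1. -/
theorem eigenvalue_recurrence {w : Basis (Fin (d + 1)) K V} {X Y : End K V}
    (hYw : (LinearMap.toMatrix w w Y).IsDiag)
    (hXw : IsIrreducibleTridiagonal (LinearMap.toMatrix w w X)) (a b : K)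
    (h : X * (X * Y + Y * X) + (X * Y + Y * X) * X = a • (X * Y + Y * X) - b • Y)
    (i j k : Fin (d + 1)) (hij : (i : ℕ) + 1 = j) (hjk : (j : ℕ) + 1 = k) :
    LinearMap.toMatrix w w Y i i + 2 * LinearMap.toMatrix w w Y j j +
      LinearMap.toMatrix w w Y k k = 0 := by
  have hX1 := hXw.1.hasLowerBandwidth
  have hY0 := hasLowerBandwidth_of_isDiag hYw
  have h1 := (hX1.mul hY0).add ((hY0.mul hX1).mono (q := 1 + 0) le_rfl)
  have hm := congrArg (LinearMap.toMatrix w w) h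
  simp only [map_sub, map_add, map_smul, LinearMap.toMatrix_mul] at hm
  have h' := congrFun (congrFun hm k) i
  rw [Matrix.sub_apply, Matrix.smul_apply, Matrix.smul_apply, h1 k i (by omega),
    hY0 k i (by omega), mul_add, add_mul, Matrix.add_apply, Matrix.add_apply, Matrix.add_apply,
    hX1.mul_apply (hX1.mul hY0) (j := j) (by omega) (by omega),
    hX1.mul_apply (hY0.mul hX1) (j := j) (by omega) (by omega),
    (hX1.mul hY0).mul_apply hX1 (j := j) (by omega) (by omega),
    (hY0.mul hX1).mul_apply hX1 (j := j) (by omega) (by omega),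
    hX1.mul_apply hY0 (j := i) (by omega) (by omega),
    hX1.mul_apply hY0 (j := j) (by omega) (by omega),
    hY0.mul_apply hX1 (j := j) (by omega) (by omega),
    hY0.mul_apply hX1 (j := k) (by omega) (by omega)] at h'
  have hne := mul_ne_zero (hXw.2 j k hjk).2 (hXw.2 i j hij).2
  refine (mul_eq_zero.mp ?_).resolve_left hne
  simp only [smul_zero, sub_zero] at h'
  linear_combination h'

end Eigenbases

/-! ### Alternating eigenvalue sums and alternating ratios of entries -/

section AntiCommutingNeighbours

variable {K : Type*} [Field K] {d : ℕ}

/-- The recurrence says that consecutive neighbour sums are opposite. -/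
theorem add_eq_of_recurrence {φ : Fin (d + 1) → K}
    (h : ∀ i j k : Fin (d + 1), (i : ℕ) + 1 = j → (j : ℕ) + 1 = k → φ i + 2 * φ j + φ k = 0)
    (hd : 1 < d + 1) (i j : Fin (d + 1)) (hij : (i : ℕ) + 1 = j) :
    φ i + φ j = (-1) ^ (i : ℕ) * (φ 0 + φ ⟨1, hd⟩) := by
  rcases i with ⟨n, hn⟩
  induction n generalizing j with
  | zero =>
    obtain rfl : j = ⟨1, hd⟩ := Fin.ext (by simpa using hij.symm)
    simp
  | succ n ih =>
    have h1 := ih ⟨n + 1, hn⟩ (by omega) rfl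
    have h2 := h ⟨n, by omega⟩ ⟨n + 1, hn⟩ j rfl hij
    simp only [pow_succ] at h1 ⊢
    linear_combination h2 - h1

theorem add_ne_zero_of_recurrence {φ : Fin (d + 1) → K} (hφ : Function.Injective φ)
    (h : ∀ i j k : Fin (d + 1), (i : ℕ) + 1 = j → (j : ℕ) + 1 = k → φ i + 2 * φ j + φ k = 0)
    (hd : 2 < d + 1) : φ 0 + φ ⟨1, by omega⟩ ≠ 0 := by
  intro h0
  have h1 := h 0 ⟨1, by omega⟩ ⟨2, hd⟩ (by simp) (by simp)
  have h2 : φ 0 = φ ⟨2, hd⟩ := by linear_combination 2 * h0 - h1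
  simpa using congrArg Fin.val (hφ h2)

/-- The alternating ratios of two irreducible tridiagonal matrices agree below and above the
diagonal. -/
theorem ratio_eq_of_relation {P Q : Matrix (Fin (d + 1)) (Fin (d + 1)) K} (hd : 3 ≤ d)
    (hP : IsIrreducibleTridiagonal P) (hQ : IsTridiagonal Q)
    (hPd : ∀ i : Fin (d + 1), 1 ≤ (i : ℕ) → (i : ℕ) + 1 ≤ d → P i i = 0)
    (hQd : ∀ i : Fin (d + 1), 1 ≤ (i : ℕ) → (i : ℕ) + 1 ≤ d → Q i i = 0)
    {a : K} (ha : a ≠ 0) (hPQ : P * (P * Q + Q * P) + (P * Q + Q * P) * P = a • Q) {β γ : K}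
    (hβ : ∀ i j : Fin (d + 1), (i : ℕ) + 1 = j → Q j i = β * (-1) ^ (i : ℕ) * P j i)
    (hγ : ∀ i j : Fin (d + 1), (i : ℕ) + 1 = j → Q i j = γ * (-1) ^ (i : ℕ) * P i j) :
    β = γ := by
  obtain ⟨i, hi⟩ : ∃ i : Fin (d + 1), (i : ℕ) = 0 := ⟨⟨0, by omega⟩, rfl⟩
  obtain ⟨j, hj⟩ : ∃ j : Fin (d + 1), (j : ℕ) = 1 := ⟨⟨1, by omega⟩, rfl⟩
  obtain ⟨k, hk⟩ : ∃ k : Fin (d + 1), (k : ℕ) = 2 := ⟨⟨2, by omega⟩, rfl⟩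
  obtain ⟨l, hl⟩ : ∃ l : Fin (d + 1), (l : ℕ) = 3 := ⟨⟨3, by omega⟩, rfl⟩
  have rj : ∀ {B : Matrix (Fin (d + 1)) (Fin (d + 1)) K}, IsTridiagonal B → B j j = 0 →
      ∀ (C : Matrix (Fin (d + 1)) (Fin (d + 1)) K) x, (B * C) j x = B j i * C i x + B j k * C k x := fun hB h C x =>
    hB.mul_apply_of_diag_eq_zero h (by omega) (by omega) C x
  have rk : ∀ {B : Matrix (Fin (d + 1)) (Fin (d + 1)) K}, IsTridiagonal B → B k k = 0 →
      ∀ (C : Matrix (Fin (d + 1)) (Fin (d + 1)) K) x, (B * C) k x = B k j * C j x + B k l * C l x := fun hB h C x =>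
    hB.mul_apply_of_diag_eq_zero h (by omega) (by omega) C x
  have cj : ∀ {B : Matrix (Fin (d + 1)) (Fin (d + 1)) K}, IsTridiagonal B → B j j = 0 →
      ∀ (C : Matrix (Fin (d + 1)) (Fin (d + 1)) K) x, (C * B) x j = C x i * B i j + C x k * B k j := fun hB h C x =>
    hB.mul_apply_of_diag_eq_zero' h (by omega) (by omega) C x
  have ck : ∀ {B : Matrix (Fin (d + 1)) (Fin (d + 1)) K}, IsTridiagonal B → B k k = 0 →
      ∀ (C : Matrix (Fin (d + 1)) (Fin (d + 1)) K) x, (C * B) x k = C x j * B j k + C x l * B l k := fun hB h C x =>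
    hB.mul_apply_of_diag_eq_zero' h (by omega) (by omega) C x
  have Pj := hPd j (by omega) (by omega)
  have Pk := hPd k (by omega) (by omega)
  have Qj := hQd j (by omega) (by omega)
  have Qk := hQd k (by omega) (by omega)
  have Pil : P i l = 0 := by
    by_contra h
    have := hP.1 _ _ h
    omega
  have Pli : P l i = 0 := by
    by_contra h
    have := hP.1 _ _ h
    omega
  have Qil : Q i l = 0 := by
    by_contra h
    have := hQ _ _ h
    omega
  have Qli : Q l i = 0 := by
    by_contra h
    have := hQ _ _ h
    omega
  have b1 := hβ i j (by omega)
  have b2 := hβ j k (by omega)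
  have b3 := hβ k l (by omega)
  have c1 := hγ i j (by omega)
  have c2 := hγ j k (by omega)
  have c3 := hγ k l (by omega)
  rw [hi] at b1 c1
  rw [hj] at b2 c2
  rw [hk] at b3 c3
  -- Expanded over walks of length three, the left-hand sides at `(k, j)` and `(j, k)` are `P k j`
  -- and `P j k` times one common factor, symmetric in `β` and `γ`. The right-hand sides are `-a β P
  -- k j` and `-a γ P j k`, so cross-multiplying gives `β = γ`.
  have e1 := congrFun (congrFun hPQ k) j
  have e2 := congrFun (congrFun hPQ j) k
  simp only [mul_add, add_mul, Matrix.add_apply, Matrix.smul_apply, smul_eq_mul] at e1 e2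
  simp only [rk hP.1 Pk, cj hP.1 Pj, rk hQ Qk, cj hQ Qj, b1, b2, b3, c1, c2, c3, Pli, Qli] at e1
  simp only [rj hP.1 Pj, ck hP.1 Pk, rj hQ Qj, ck hQ Qk, b1, b2, b3, c1, c2, c3, Pil, Qil] at e2
  obtain ⟨hjk, hkj⟩ := hP.2 j k (by omega)
  have hne : a * (P j k * P k j) ≠ 0 := mul_ne_zero ha (mul_ne_zero hjk hkj)
  refine sub_eq_zero.mp ((mul_eq_zero.mp ?_).resolve_left hne)
  linear_combination P j k * e1 - P k j * e2

theorem exists_eq_neg_one_pow_mul {P Q : Matrix (Fin (d + 1)) (Fin (d + 1)) K} (hd : 1 < d + 1)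
    (hP : IsIrreducibleTridiagonal P)
    (h : ∀ i j k : Fin (d + 1), (i : ℕ) + 1 = j → (j : ℕ) + 1 = k →
      Q j i * P k j + Q k j * P j i = 0) :
    ∃ β : K, ∀ i j : Fin (d + 1), (i : ℕ) + 1 = j → Q j i = β * (-1) ^ (i : ℕ) * P j i := by
  refine ⟨Q ⟨1, hd⟩ 0 / P ⟨1, hd⟩ 0, ?_⟩
  rintro ⟨n, hn⟩ j hj
  induction n generalizing j with
  | zero =>
    obtain rfl : j = ⟨1, hd⟩ := Fin.ext (by simpa using hj.symm)
    have := (hP.2 0 ⟨1, hd⟩ (by simp)).2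
    simp only [Fin.zero_eta, pow_zero]
    field_simp
  | succ n ih =>
    have h1 := ih (by omega) ⟨n + 1, hn⟩ rfl
    have h2 := h ⟨n, by omega⟩ ⟨n + 1, hn⟩ j rfl hj
    have h3 := (hP.2 ⟨n, by omega⟩ ⟨n + 1, hn⟩ rfl).2
    refine mul_right_cancel₀ h3 ?_
    rw [h1] at h2
    simp only [pow_succ] at h1 ⊢
    linear_combination h2

variable [CharZero K]

/-- For three consecutive ratios `x`, `y`, `z` of subdiagonal entries, the entries of the two
relations three steps below the diagonal give `x + 2y + z = 0` and `xy + 2xz + yz = 0`. Eliminating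
`z` leaves `2(x + y)² = 0`, so the ratios alternate in sign. -/
theorem mul_add_mul_eq_zero_of_relation {P Q : Matrix (Fin (d + 1)) (Fin (d + 1)) K} (hd : 3 ≤ d)
    (hP : IsIrreducibleTridiagonal P) (hQ : IsIrreducibleTridiagonal Q) {a b : K}
    (hPQ : P * (P * Q + Q * P) + (P * Q + Q * P) * P = a • Q)
    (hQP : Q * (Q * P + P * Q) + (Q * P + P * Q) * Q = b • P)
    (i j k : Fin (d + 1)) (hij : (i : ℕ) + 1 = j) (hjk : (j : ℕ) + 1 = k) :
    Q j i * P k j + Q k j * P j i = 0 := by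
  have hP1 := hP.1.hasLowerBandwidth
  have hQ1 := hQ.1.hasLowerBandwidth
  have triple : ∀ i j k l : Fin (d + 1), (i : ℕ) + 1 = j → (j : ℕ) + 1 = k → (k : ℕ) + 1 = l →
      ∃ x y z, Q j i = x * P j i ∧ Q k j = y * P k j ∧ Q l k = z * P l k ∧
        x + y = 0 ∧ y + z = 0 := by
    intro i j k l hij hjk hkl
    have hp1 := (hP.2 i j hij).2
    have hp2 := (hP.2 j k hjk).2
    have hp3 := (hP.2 k l hkl).2
    refine ⟨Q j i / P j i, Q k j / P k j, Q l k / P l k, by field_simp, by field_simp,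
      by field_simp, ?_⟩
    have ex : Q j i = Q j i / P j i * P j i := by field_simp
    have ey : Q k j = Q k j / P k j * P k j := by field_simp
    have ez : Q l k = Q l k / P l k * P l k := by field_simp
    set x := Q j i / P j i
    set y := Q k j / P k j
    set z := Q l k / P l k
    have e1 := congrFun (congrFun hPQ l) i
    have e2 := congrFun (congrFun hQP l) i
    rw [mul_add, add_mul, Matrix.add_apply, Matrix.add_apply, Matrix.add_apply,
      hP1.mul_apply (hP1.mul hQ1) (j := k) (by omega) (by omega),
      hP1.mul_apply (hQ1.mul hP1) (j := k) (by omega) (by omega),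
      (hP1.mul hQ1).mul_apply hP1 (j := j) (by omega) (by omega),
      (hQ1.mul hP1).mul_apply hP1 (j := j) (by omega) (by omega),
      hP1.mul_apply hQ1 (j := j) (by omega) (by omega),
      hQ1.mul_apply hP1 (j := j) (by omega) (by omega),
      hP1.mul_apply hQ1 (j := k) (by omega) (by omega),
      hQ1.mul_apply hP1 (j := k) (by omega) (by omega),
      Matrix.smul_apply, hQ1 l i (by omega), smul_zero, ex, ey, ez] at e1
    rw [mul_add, add_mul, Matrix.add_apply, Matrix.add_apply, Matrix.add_apply,
      hQ1.mul_apply (hQ1.mul hP1) (j := k) (by omega) (by omega),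
      hQ1.mul_apply (hP1.mul hQ1) (j := k) (by omega) (by omega),
      (hQ1.mul hP1).mul_apply hQ1 (j := j) (by omega) (by omega),
      (hP1.mul hQ1).mul_apply hQ1 (j := j) (by omega) (by omega),
      hQ1.mul_apply hP1 (j := j) (by omega) (by omega),
      hP1.mul_apply hQ1 (j := j) (by omega) (by omega),
      hQ1.mul_apply hP1 (j := k) (by omega) (by omega),
      hP1.mul_apply hQ1 (j := k) (by omega) (by omega),
      Matrix.smul_apply, hP1 l i (by omega), smul_zero, ex, ey, ez] at e2
    have hne : P j i * P k j * P l k ≠ 0 := mul_ne_zero (mul_ne_zero hp1 hp2) hp3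
    have f1 : x + 2 * y + z = 0 := by
      refine (mul_eq_zero.mp ?_).resolve_left hne
      linear_combination e1
    have f2 : x * y + 2 * x * z + y * z = 0 := by
      refine (mul_eq_zero.mp ?_).resolve_left hne
      linear_combination e2
    have f3 : 2 * (x + y) ^ 2 = 0 := by
      linear_combination (2 * x + y) * f1 - f2
    have f4 : x + y = 0 := by simpa using f3
    exact ⟨f4, by linear_combination f1 - f4⟩
  by_cases hk : (k : ℕ) + 1 < d + 1
  · obtain ⟨x, y, z, ex, ey, -, h, -⟩ := triple i j k ⟨k + 1, hk⟩ hij hjk rfl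
    rw [ex, ey]
    linear_combination P j i * P k j * h
  -- Here `k = d`, so the window extends upwards instead; `d ≥ 3` ensures `i ≥ 1`.
  · obtain ⟨x, y, z, -, ey, ez, -, h⟩ := triple ⟨i - 1, by omega⟩ i j k
      (by simp; omega) hij hjk
    rw [ey, ez]
    linear_combination P j i * P k j * h

end AntiCommutingNeighbours

/-! ### The anticommutator relations of the triple -/

section Relations

variable {K V : Type*} [Field K] [AddCommGroup V] [Module K V] {d : ℕ}

/-- The common weakening of `IsBipartite` and `IsAlmostBipartite`, as far as the diagonal is
concerned. -/
def HasSparseDiagonal (B : Matrix (Fin (d + 1)) (Fin (d + 1)) K) : Prop :=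
  (∃ c, ∀ i, i ≠ c → B i i = 0) ∧
    ∀ i : Fin (d + 1), 1 ≤ (i : ℕ) → (i : ℕ) + 1 ≤ d → B i i = 0

theorem IsBipartite.hasSparseDiagonal {B : Matrix (Fin (d + 1)) (Fin (d + 1)) K}
    (hB : IsBipartite B) : HasSparseDiagonal B :=
  ⟨⟨0, fun i _ => hB.2 i⟩, fun i _ _ => hB.2 i⟩

theorem IsAlmostBipartite.hasSparseDiagonal {B : Matrix (Fin (d + 1)) (Fin (d + 1)) K}
    (hB : IsAlmostBipartite B) : HasSparseDiagonal B := by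
  obtain ⟨-, hx, hi⟩ := hB
  refine ⟨?_, hi⟩
  rcases hx with ⟨-, h⟩ | ⟨-, h⟩
  · refine ⟨0, fun i hi0 => ?_⟩
    by_cases hl : i = Fin.last d
    · rw [hl]
      exact not_not.mp h
    · refine hi i ?_ ?_
      · exact Nat.one_le_iff_ne_zero.mpr fun h => hi0 (Fin.ext h)
      · have := Fin.val_lt_last hl
        omega
  · refine ⟨Fin.last d, fun i hl => ?_⟩
    by_cases hi0 : i = 0
    · rw [hi0]
      exact not_not.mp h
    · refine hi i ?_ ?_
      · exact Nat.one_le_iff_ne_zero.mpr fun h => hi0 (Fin.ext h)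
      · have := Fin.val_lt_last hl
        omega

/-- Neighbour sums take only the values `s` and `-s`, so the anticommutator term drops out and `ρ =
s²`; distinctness of the eigenvalues makes `s` nonzero. -/
theorem exists_relation_of_recurrence {v w : Basis (Fin (d + 1)) K V} {X Y : End K V}
    (hd : 3 ≤ d) (hXv : (LinearMap.toMatrix v v X).IsDiag)
    (hYv : IsTridiagonal (LinearMap.toMatrix v v Y)) (hYw : (LinearMap.toMatrix w w Y).IsDiag)
    (hXw : IsIrreducibleTridiagonal (LinearMap.toMatrix w w X))
    (hc : HasSparseDiagonal (LinearMap.toMatrix v v Y))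
    (h : ∀ i j k : Fin (d + 1), (i : ℕ) + 1 = j → (j : ℕ) + 1 = k →
      LinearMap.toMatrix v v X i i + 2 * LinearMap.toMatrix v v X j j +
        LinearMap.toMatrix v v X k k = 0) :
    ∃ ρ : K, ρ ≠ 0 ∧ X * (X * Y + Y * X) + (X * Y + Y * X) * X = ρ • Y := by
  have hd1 : 1 < d + 1 := by omega
  set s := LinearMap.toMatrix v v X 0 0 + LinearMap.toMatrix v v X ⟨1, hd1⟩ ⟨1, hd1⟩ with hs
  have hs0 : s ≠ 0 := add_ne_zero_of_recurrence (eigenvalue_injective hXv hXw) h (by omega)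
  refine ⟨s * s, mul_ne_zero hs0 hs0, ?_⟩
  rw [anticommutator_relation hd hXv hYv hYw hXw hc.1 s (-s) fun i j hij => ?_]
  · simp
  · have := add_eq_of_recurrence (φ := fun i => LinearMap.toMatrix v v X i i) h hd1 i j hij
    rw [show LinearMap.toMatrix v v X i i + LinearMap.toMatrix v v X j j = _ from this]
    rcases neg_one_pow_eq_or K (i : ℕ) with e | e <;> simp [e, hs]

/-- Clearing denominators, the Bannai/Ito condition says that neighbour sums are 2-periodic. -/
theorem exists_sums_of_isBannaiItoType {A As Ae : End K V} {v : Basis (Fin (d + 1)) K V}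
    (hd : 3 ≤ d) (hv : IsStandardBasis v A As Ae) (hBI : IsBannaiItoType d A As Ae) :
    ∃ s t : K, ∀ i j : Fin (d + 1), (i : ℕ) + 1 = j →
      LinearMap.toMatrix v v A i i + LinearMap.toMatrix v v A j j = s ∨
      LinearMap.toMatrix v v A i i + LinearMap.toMatrix v v A j j = t := by
  have hrec := hBI.2 v hv _ (apply_basis_of_isDiag hv.1)
  set θ := fun i => LinearMap.toMatrix v v A i i with hθ
  refine ⟨θ ⟨0, by omega⟩ + θ ⟨1, by omega⟩, θ ⟨1, by omega⟩ + θ ⟨2, by omega⟩, ?_⟩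
  rintro ⟨n, hn⟩ ⟨m, hm⟩ hnm
  simp only at hnm
  subst hnm
  induction n using Nat.strong_induction_on with
  | _ n ih =>
    match n, ih with
    | 0, _ => exact Or.inl rfl
    | 1, _ => exact Or.inr rfl
    | n + 2, ih =>
      have h1 := ih n (by omega) (by omega) (by omega)
      have h2 := hrec (n + 2) (by omega) (by omega)
      -- Division by zero yields `0`, which is not `-1`, so the condition itself excludes a zero
      -- denominator.
      have h3 : θ ⟨n + 2 - 1, by omega⟩ - θ ⟨n + 2, hn⟩ ≠ 0 := by
        intro h0
        rw [h0, div_zero] at h2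
        exact one_ne_zero (neg_eq_zero.mp h2.symm)
      rw [div_eq_iff h3] at h2
      have h4 : θ ⟨n + 2, hn⟩ + θ ⟨n + 2 + 1, hm⟩ =
          θ ⟨n, by omega⟩ + θ ⟨n + 1, by omega⟩ := by
        simp only [Nat.add_sub_cancel, show n + 2 - 1 = n + 1 from rfl] at h2
        linear_combination -h2
      rw [← h4] at h1
      exact h1

variable [CharZero K]

/-- Each map of a totally B/AB Leonard triple of Bannai/Ito type is a multiple of the
anticommutator of the other two. -/
theorem exists_anticommutators {A As Ae : End K V} (hd : 3 ≤ d)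
    {v w u : Basis (Fin (d + 1)) K V} (hv : IsStandardBasis v A As Ae)
    (hw : IsStandardBasis w As Ae A) (hu : IsStandardBasis u Ae A As)
    (hvs : HasSparseDiagonal (LinearMap.toMatrix v v As))
    (hve : HasSparseDiagonal (LinearMap.toMatrix v v Ae))
    (hwe : HasSparseDiagonal (LinearMap.toMatrix w w Ae))
    (hwa : HasSparseDiagonal (LinearMap.toMatrix w w A))
    (hus : HasSparseDiagonal (LinearMap.toMatrix u u As))
    (hBI : IsBannaiItoType d A As Ae) :
    ∃ n₁ n₂ n₃ : K, n₁ ≠ 0 ∧ n₂ ≠ 0 ∧ n₃ ≠ 0 ∧ A * As + As * A = n₃ • Ae ∧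
      As * Ae + Ae * As = n₁ • A ∧ Ae * A + A * Ae = n₂ • As := by
  obtain ⟨hvA, hvS, hvE⟩ := hv
  obtain ⟨hwS, hwE, hwA⟩ := hw
  obtain ⟨huE, huA, huS⟩ := hu
  obtain ⟨s, t, hst⟩ := exists_sums_of_isBannaiItoType hd ⟨hvA, hvS, hvE⟩ hBI
  -- The Bannai/Ito condition concerns `A` alone. It gives relations with general `s`, `t`, hence
  -- the recurrence for `As` and `Ae`; the resulting relation between `As` and `A` then returns the
  -- recurrence for `A`.
  have recS := eigenvalue_recurrence hwS hwA _ _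
    (anticommutator_relation hd hvA hvS.1 hwS hwA hvs.1 s t hst)
  have recE := eigenvalue_recurrence huE huA _ _
    (anticommutator_relation hd hvA hvE.1 huE huA hve.1 s t hst)
  obtain ⟨ρ₁, hρ₁, relSA⟩ := exists_relation_of_recurrence hd hwS hwA.1 hvA hvS hwa recS
  have recA := eigenvalue_recurrence (a := 0) (b := -ρ₁) hvA hvS (by simpa using relSA)
  obtain ⟨ρ₂, hρ₂, relAS⟩ := exists_relation_of_recurrence hd hvA hvS.1 hwS hwA hvs recA
  obtain ⟨ρ₃, hρ₃, relSE⟩ := exists_relation_of_recurrence hd hwS hwE.1 huE huS hwe recS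
  obtain ⟨ρ₄, hρ₄, relES⟩ := exists_relation_of_recurrence hd huE huS.1 hwS hwE hus recE
  have hd1 : 1 < d + 1 := by omega
  set θ := fun i => LinearMap.toMatrix v v A i i with hθ
  set r := θ 0 + θ ⟨1, hd1⟩ with hr
  have hr0 : r ≠ 0 := add_ne_zero_of_recurrence (eigenvalue_injective hvA hwA) recA (by omega)
  have hsum := add_eq_of_recurrence (φ := θ) recA hd1
  set P := LinearMap.toMatrix v v As with hP
  set Q := LinearMap.toMatrix v v Ae with hQ
  have hPQ : P * (P * Q + Q * P) + (P * Q + Q * P) * P = ρ₃ • Q := by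
    simpa only [map_add, map_smul, LinearMap.toMatrix_mul] using
      congrArg (LinearMap.toMatrix v v) relSE
  have hQP : Q * (Q * P + P * Q) + (Q * P + P * Q) * Q = ρ₄ • P := by
    simpa only [map_add, map_smul, LinearMap.toMatrix_mul] using
      congrArg (LinearMap.toMatrix v v) relES
  -- The relations are stable under transposition, so the subdiagonal argument applies to the
  -- superdiagonal as well.
  have hPQt : P.transpose * (P.transpose * Q.transpose + Q.transpose * P.transpose) +
      (P.transpose * Q.transpose + Q.transpose * P.transpose) * P.transpose =
        ρ₃ • Q.transpose := by
    rw [← Matrix.transpose_smul, ← hPQ]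
    simp only [Matrix.transpose_add, Matrix.transpose_mul, mul_add, add_mul, mul_assoc]
    abel
  have hQPt : Q.transpose * (Q.transpose * P.transpose + P.transpose * Q.transpose) +
      (Q.transpose * P.transpose + P.transpose * Q.transpose) * Q.transpose =
        ρ₄ • P.transpose := by
    rw [← Matrix.transpose_smul, ← hQP]
    simp only [Matrix.transpose_add, Matrix.transpose_mul, mul_add, add_mul, mul_assoc]
    abel
  obtain ⟨β, hβ⟩ := exists_eq_neg_one_pow_mul hd1 hvS
    (mul_add_mul_eq_zero_of_relation hd hvS hvE hPQ hQP)
  obtain ⟨γ, hγ⟩ := exists_eq_neg_one_pow_mul hd1 hvS.transpose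
    (mul_add_mul_eq_zero_of_relation hd hvS.transpose hvE.transpose hPQt hQPt)
  simp only [Matrix.transpose_apply] at hγ
  obtain rfl : β = γ := ratio_eq_of_relation hd hvS hvE.1 hvs.2 hve.2 hρ₃ hPQ hβ hγ
  have hβ0 : β ≠ 0 := by
    rintro rfl
    refine (hvE.2 0 ⟨1, hd1⟩ (by simp)).2 ?_
    rw [hβ 0 ⟨1, hd1⟩ (by simp)]
    simp
  -- Off the diagonal the signs `(-1)^i` in the neighbour sums and in the ratios match. What remains
  -- is diagonal in `v`, of bandwidth 1 in `w`, and zero at the interior indices 1 and 2, which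
  -- suffices for rigidity.
  have key : r • Ae - β • (A * As + As * A) = 0 := by
    have hM : ∀ i j, LinearMap.toMatrix v v (r • Ae - β • (A * As + As * A)) i j =
        r * Q i j - β * ((θ i + θ j) * P i j) := by
      intro i j
      obtain ⟨D, hD⟩ : ∃ D, LinearMap.toMatrix v v A = Matrix.diagonal D :=
        ⟨_, hvA.diagonal_diag.symm⟩
      simp only [hθ, map_sub, map_add, map_smul, LinearMap.toMatrix_mul, hD, Matrix.add_apply,
        Matrix.sub_apply, Matrix.smul_apply, Matrix.diagonal_mul, Matrix.mul_diagonal,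
        Matrix.diagonal_apply_eq, smul_eq_mul, ← hP, ← hQ]
      ring
    refine eq_zero_of_isDiag_of_hasLowerBandwidth hvA hwA (m := 1) ?_ ?_
      {⟨1, hd1⟩, ⟨2, by omega⟩} ?_ ?_
    · intro i j hij
      rw [hM]
      by_cases h1 : (i : ℕ) + 1 = j
      · rw [hγ i j h1, hsum i j h1]
        ring
      by_cases h2 : (j : ℕ) + 1 = i
      · rw [hβ j i h2, add_comm (θ i), hsum j i h2]
        ring
      have hne : (i : ℕ) ≠ j := fun h => hij (Fin.ext h)
      have hP0 : P i j = 0 := by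
        by_contra h
        have := hvS.1 i j h
        omega
      have hQ0 : Q i j = 0 := by
        by_contra h
        have := hvE.1 i j h
        omega
      rw [hP0, hQ0]
      ring
    · simp only [map_sub, map_add, map_smul, LinearMap.toMatrix_mul]
      have hS0 := hasLowerBandwidth_of_isDiag hwS
      have hA1 := hwA.1.hasLowerBandwidth
      exact (hwE.1.hasLowerBandwidth.smul _).sub
        (((hA1.mul hS0).add ((hS0.mul hA1).mono (by omega))).smul _)
    · rw [Finset.card_pair (by simp)]
      norm_num
    · intro i hi
      have hi' : (i : ℕ) = 1 ∨ (i : ℕ) = 2 := by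
        simpa [Fin.ext_iff] using hi
      rw [hM, hvs.2 i (by omega) (by omega), hve.2 i (by omega) (by omega)]
      ring
  have hn₃ : r / β ≠ 0 := div_ne_zero hr0 hβ0
  have e₃ : A * As + As * A = (r / β) • Ae := by
    rw [div_eq_inv_mul, mul_smul, sub_eq_zero.mp key, inv_smul_smul₀ hβ0]
  refine ⟨ρ₁ / (r / β), ρ₂ / (r / β), r / β, div_ne_zero hρ₁ hn₃, div_ne_zero hρ₂ hn₃, hn₃, e₃,
    ?_, ?_⟩
  -- Replacing the inner anticommutator of a cubic relation by its multiple of `Ae` leaves another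
  -- anticommutator relation.
  · rw [add_comm (As * A), e₃, mul_smul_comm, smul_mul_assoc, ← smul_add] at relSA
    rw [div_eq_inv_mul, mul_smul, ← relSA, inv_smul_smul₀ hn₃]
  · rw [e₃, mul_smul_comm, smul_mul_assoc, ← smul_add, add_comm (A * Ae)] at relAS
    rw [div_eq_inv_mul, mul_smul, ← relAS, inv_smul_smul₀ hn₃]

end Relations

/-! ### Rescaling and the count of normalizing scalars -/

section Rescaling

variable {K V : Type*} [Field K] [AddCommGroup V] [Module K V] {d : ℕ}

theorem isTridiagonal_smul_iff {x : K} (hx : x ≠ 0) {B : Matrix (Fin (d + 1)) (Fin (d + 1)) K} :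
    IsTridiagonal (x • B) ↔ IsTridiagonal B := by
  simp [IsTridiagonal, hx]

theorem isIrreducibleTridiagonal_smul_iff {x : K} (hx : x ≠ 0)
    {B : Matrix (Fin (d + 1)) (Fin (d + 1)) K} :
    IsIrreducibleTridiagonal (x • B) ↔ IsIrreducibleTridiagonal B := by
  simp [IsIrreducibleTridiagonal, isTridiagonal_smul_iff hx, hx]

theorem isBipartite_smul_iff {x : K} (hx : x ≠ 0) {B : Matrix (Fin (d + 1)) (Fin (d + 1)) K} :
    IsBipartite (x • B) ↔ IsBipartite B := by
  simp [IsBipartite, isTridiagonal_smul_iff hx, hx]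

theorem isAlmostBipartite_smul_iff {x : K} (hx : x ≠ 0)
    {B : Matrix (Fin (d + 1)) (Fin (d + 1)) K} :
    IsAlmostBipartite (x • B) ↔ IsAlmostBipartite B := by
  simp [IsAlmostBipartite, isTridiagonal_smul_iff hx, hx]

theorem isDiag_smul_iff {x : K} (hx : x ≠ 0) {B : Matrix (Fin (d + 1)) (Fin (d + 1)) K} :
    (x • B).IsDiag ↔ B.IsDiag := by
  simp [Matrix.IsDiag, Pairwise, hx]

variable {A As Ae : End K V} {x y z : K}

theorem isStandardBasis_smul_iff (hx : x ≠ 0) (hy : y ≠ 0) (hz : z ≠ 0)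
    {b : Basis (Fin (d + 1)) K V} :
    IsStandardBasis b (x • A) (y • As) (z • Ae) ↔ IsStandardBasis b A As Ae := by
  simp only [IsStandardBasis, map_smul, isDiag_smul_iff hx, isIrreducibleTridiagonal_smul_iff hy,
    isIrreducibleTridiagonal_smul_iff hz]

theorem isLeonardTriple_smul_iff (hx : x ≠ 0) (hy : y ≠ 0) (hz : z ≠ 0) :
    IsLeonardTriple d (x • A) (y • As) (z • Ae) ↔ IsLeonardTriple d A As Ae := by
  simp only [IsLeonardTriple, isStandardBasis_smul_iff hx hy hz, isStandardBasis_smul_iff hy hz hx,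
    isStandardBasis_smul_iff hz hx hy]

theorem isTotallyBAB_smul_iff (hx : x ≠ 0) (hy : y ≠ 0) (hz : z ≠ 0) :
    IsTotallyBAB d (x • A) (y • As) (z • Ae) ↔ IsTotallyBAB d A As Ae := by
  simp only [IsTotallyBAB, IsTotallyBipartite, IsTotallyAlmostBipartite, map_smul,
    isLeonardTriple_smul_iff hx hy hz, isStandardBasis_smul_iff hx hy hz,
    isStandardBasis_smul_iff hy hz hx, isStandardBasis_smul_iff hz hx hy,
    isBipartite_smul_iff hx, isBipartite_smul_iff hy, isBipartite_smul_iff hz,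
    isAlmostBipartite_smul_iff hx, isAlmostBipartite_smul_iff hy, isAlmostBipartite_smul_iff hz]

theorem IsBannaiItoType.smul (h : IsBannaiItoType d A As Ae) (hx : x ≠ 0) (hy : y ≠ 0)
    (hz : z ≠ 0) : IsBannaiItoType d (x • A) (y • As) (z • Ae) := by
  refine ⟨(isLeonardTriple_smul_iff hx hy hz).mpr h.1, fun b hb θ hθ i hi hid => ?_⟩
  have := h.2 b ((isStandardBasis_smul_iff hx hy hz).mp hb) (fun j => x⁻¹ * θ j) (fun j => by
    rw [mul_smul, ← hθ j, LinearMap.smul_apply, inv_smul_smul₀ hx]) i hi hid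
  rwa [← mul_sub, ← mul_sub, mul_div_mul_left _ _ (inv_ne_zero hx)] at this

theorem smul_mul_smul_add_eq_iff {X Y Z : End K V} (hZ : Z ≠ 0) {n : K}
    (h : X * Y + Y * X = n • Z) :
    (x • X) * (y • Y) + (y • Y) * (x • X) = (2 : K) • (z • Z) ↔ x * y * n = 2 * z := by
  rw [smul_mul_smul_comm, smul_mul_smul_comm, mul_comm y x, ← smul_add, h, smul_smul, smul_smul]
  exact (smul_left_injective K hZ).eq_iff

variable [CharZero K]

/-- Rescaling preserves everything but the three normalization equations. The first determines `z`;
substituting it in the others and cancelling `y` or `x` gives the two squares. -/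
theorem mem_normalizingScalars_iff (hBAB : IsTotallyBAB d A As Ae)
    (hBI : IsBannaiItoType d A As Ae) (hA : A ≠ 0) (hAs : As ≠ 0) (hAe : Ae ≠ 0) {n₁ n₂ n₃ : K}
    (h₁ : n₁ ≠ 0) (h₂ : n₂ ≠ 0) (h₃ : n₃ ≠ 0) (e₃ : A * As + As * A = n₃ • Ae)
    (e₁ : As * Ae + Ae * As = n₁ • A) (e₂ : Ae * A + A * Ae = n₂ • As) (ξ : K × K × K) :
    ξ ∈ normalizingScalars d A As Ae ↔
      ξ.1 ^ 2 = 4 / (n₂ * n₃) ∧ ξ.2.1 ^ 2 = 4 / (n₁ * n₃) ∧ ξ.2.2 = ξ.1 * ξ.2.1 * n₃ / 2 := by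
  obtain ⟨x, y, z⟩ := ξ
  have h4 : (4 : K) ≠ 0 := OfNat.ofNat_ne_zero 4
  have h2 : (2 : K) ≠ 0 := two_ne_zero
  simp only [normalizingScalars, Set.mem_ofPred_eq, IsNormalized, smul_mul_smul_add_eq_iff hAe e₃,
    smul_mul_smul_add_eq_iff hA e₁, smul_mul_smul_add_eq_iff hAs e₂]
  constructor
  · rintro ⟨hx, hy, hz, -, -, f₃, f₁, f₂⟩
    refine ⟨?_, ?_, ?_⟩
    · rw [eq_div_iff (mul_ne_zero h₂ h₃)]
      refine mul_right_cancel₀ hy ?_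
      linear_combination (x * n₂) * f₃ + 2 * f₂
    · rw [eq_div_iff (mul_ne_zero h₁ h₃)]
      refine mul_right_cancel₀ hx ?_
      linear_combination (y * n₁) * f₃ + 2 * f₁
    · rw [eq_div_iff h2]
      linear_combination -f₃
  · rintro ⟨f₁, f₂, f₃⟩
    have hx : x ≠ 0 := by
      rintro rfl
      exact div_ne_zero h4 (mul_ne_zero h₂ h₃) (by simpa using f₁.symm)
    have hy : y ≠ 0 := by
      rintro rfl
      exact div_ne_zero h4 (mul_ne_zero h₁ h₃) (by simpa using f₂.symm)
    have hz : z ≠ 0 := by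
      rw [f₃]
      exact div_ne_zero (mul_ne_zero (mul_ne_zero hx hy) h₃) h2
    rw [eq_div_iff (mul_ne_zero h₂ h₃)] at f₁
    rw [eq_div_iff (mul_ne_zero h₁ h₃)] at f₂
    rw [eq_div_iff h2] at f₃
    refine ⟨hx, hy, hz, (isTotallyBAB_smul_iff hx hy hz).mpr hBAB, hBI.smul hx hy hz, ?_, ?_, ?_⟩
    · linear_combination -f₃
    · refine mul_right_cancel₀ h2 ?_
      linear_combination y * n₁ * f₃ + x * f₂
    · refine mul_right_cancel₀ h2 ?_
      linear_combination x * n₂ * f₃ + y * f₁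

theorem ncard_sign_choices [IsAlgClosed K] {a b n : K} (ha : a ≠ 0) (hb : b ≠ 0) :
    {ξ : K × K × K | ξ.1 ^ 2 = a ∧ ξ.2.1 ^ 2 = b ∧ ξ.2.2 = ξ.1 * ξ.2.1 * n / 2}.ncard = 4 := by
  obtain ⟨x, rfl⟩ := IsAlgClosed.exists_pow_nat_eq a (n := 2) (by norm_num)
  obtain ⟨y, rfl⟩ := IsAlgClosed.exists_pow_nat_eq b (n := 2) (by norm_num)
  have hx : x ≠ -x := fun h => ha (by rw [self_eq_neg.mp h]; simp)
  have hy : y ≠ -y := fun h => hb (by rw [self_eq_neg.mp h]; simp)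
  have himage : {ξ : K × K × K | ξ.1 ^ 2 = x ^ 2 ∧ ξ.2.1 ^ 2 = y ^ 2 ∧
      ξ.2.2 = ξ.1 * ξ.2.1 * n / 2} =
        (fun p : K × K => (p.1, p.2, p.1 * p.2 * n / 2)) '' (({x, -x} : Set K) ×ˢ {y, -y}) := by
    ext ⟨p, q, r⟩
    simp only [Set.mem_ofPred_eq, sq_eq_sq_iff_eq_or_eq_neg, Set.mem_image, Set.mem_prod,
      Set.mem_insert_iff, Set.mem_singleton_iff, Prod.exists, Prod.mk.injEq]
    constructor
    · rintro ⟨hp, hq, hr⟩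
      exact ⟨p, q, ⟨hp, hq⟩, rfl, rfl, hr.symm⟩
    · rintro ⟨p, q, ⟨hp, hq⟩, rfl, rfl, rfl⟩
      exact ⟨hp, hq, rfl⟩
  rw [himage, Set.ncard_image_of_injective, Set.ncard_prod, Set.ncard_pair hx, Set.ncard_pair hy]
  rintro ⟨p, q⟩ ⟨p', q'⟩ h
  simp only [Prod.mk.injEq] at h
  exact Prod.ext h.1 h.2.1

end Rescaling

/-! ### Sign reflections and traces -/

section Isomorphism

variable {K V : Type*} [Field K] [AddCommGroup V] [Module K V] {d : ℕ}

/-- The reflection `v i ↦ (-1) ^ i v i` fixes the maps that are diagonal in the basis `v` and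
negates those that are bipartite. -/
theorem exists_sign_equiv (v : Basis (Fin (d + 1)) K V) :
    ∃ φ : V ≃ₗ[K] V,
      (∀ X : End K V, (LinearMap.toMatrix v v X).IsDiag → ∀ x, φ (X x) = X (φ x)) ∧
      ∀ X : End K V, IsBipartite (LinearMap.toMatrix v v X) → ∀ x, φ (X x) = -X (φ x) := by
  have hsq : ∀ i : Fin (d + 1), (-1 : K) ^ (i : ℕ) * (-1) ^ (i : ℕ) = 1 := fun i => by
    rw [← mul_pow]
    simp
  let D : Matrix (Fin (d + 1)) (Fin (d + 1)) K := Matrix.diagonal fun i => (-1) ^ (i : ℕ)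
  let S : End K V := Matrix.toLin v v D
  have hS : LinearMap.toMatrix v v S = D := LinearMap.toMatrix_toLin v v D
  have hSS : S * S = 1 := by
    apply (LinearMap.toMatrix v v).injective
    rw [LinearMap.toMatrix_mul, hS, LinearMap.toMatrix_one, Matrix.diagonal_mul_diagonal]
    simp only [hsq]
    exact Matrix.diagonal_one
  refine ⟨LinearEquiv.ofLinearMap S S hSS hSS, fun X hX x => ?_, fun X hX x => ?_⟩
  · have : S * X = X * S := by
      apply (LinearMap.toMatrix v v).injective
      rw [LinearMap.toMatrix_mul, LinearMap.toMatrix_mul, hS]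
      ext i j
      rw [Matrix.diagonal_mul, Matrix.mul_diagonal]
      by_cases h : i = j
      · rw [h, mul_comm]
      · rw [show LinearMap.toMatrix v v X i j = 0 from hX h, mul_zero, zero_mul]
    exact LinearMap.congr_fun this x
  · have : S * X = -(X * S) := by
      apply (LinearMap.toMatrix v v).injective
      rw [map_neg, LinearMap.toMatrix_mul, LinearMap.toMatrix_mul, hS]
      ext i j
      rw [Matrix.neg_apply, Matrix.diagonal_mul, Matrix.mul_diagonal]
      by_cases h : LinearMap.toMatrix v v X i j = 0
      · rw [h]
        simp
      · rcases hX.1 i j h with e | e | e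
        · obtain rfl := Fin.ext e
          exact absurd (hX.2 i) h
        · rw [← e, pow_succ]
          ring
        · rw [← e, pow_succ]
          ring
    exact LinearMap.congr_fun this x

/-- The diagonal has exactly one nonzero entry. As the trace is invariant under isomorphism, it
recovers the scalar of a rescaled map. -/
theorem trace_ne_zero_of_isAlmostBipartite {w : Basis (Fin (d + 1)) K V} {X : End K V}
    (hX : IsAlmostBipartite (LinearMap.toMatrix w w X)) (hd : 1 ≤ d) :
    LinearMap.trace K V X ≠ 0 := by
  obtain ⟨n, rfl⟩ : ∃ n, d = n + 1 := ⟨d - 1, by omega⟩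
  rw [LinearMap.trace_eq_matrix_trace K w, Matrix.trace, Fin.sum_univ_succ, Fin.sum_univ_castSucc,
    Finset.sum_eq_zero]
  · obtain ⟨-, hx, -⟩ := hX
    rw [zero_add, Fin.succ_last]
    simp only [Matrix.diag_apply]
    rcases hx with ⟨h, h'⟩ | ⟨h, h'⟩
    · rwa [not_not.mp h', add_zero]
    · rwa [not_not.mp h', zero_add]
  · intro i _
    exact hX.2.2 _ (by simp) (by simp)

theorem trace_eq_of_intertwining {W : Type*} [AddCommGroup W] [Module K W] {X : End K V}
    {Y : End K W} (φ : V ≃ₗ[K] W) (h : ∀ x, φ (X x) = Y (φ x)) :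
    LinearMap.trace K V X = LinearMap.trace K W Y := by
  have : Y = φ.conj X := LinearMap.ext fun x => by
    rw [LinearEquiv.conj_apply_apply, h, φ.apply_symm_apply]
  rw [this, LinearMap.trace_conj']

end Isomorphism

end LeonardTriple

/-! ### The proposition -/

theorem propositionP {K V : Type*} [Field K] [IsAlgClosed K] [CharZero K]
    [AddCommGroup V] [Module K V] [FiniteDimensional K V]
    (d : ℕ) (hd : 4 ≤ d + 1) (hV : Module.finrank K V = d + 1)
    (A As Ae : Module.End K V)
    (hBAB : LeonardTriple.IsTotallyBAB d A As Ae)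
    (hBI : LeonardTriple.IsBannaiItoType d A As Ae) :
    (LeonardTriple.normalizingScalars d A As Ae).ncard = 4 ∧
    (LeonardTriple.IsTotallyBipartite d A As Ae →
      ∀ ξ ∈ LeonardTriple.normalizingScalars d A As Ae,
      ∀ η ∈ LeonardTriple.normalizingScalars d A As Ae,
        LeonardTriple.Isomorphic (ξ.1 • A) (ξ.2.1 • As) (ξ.2.2 • Ae)
          (η.1 • A) (η.2.1 • As) (η.2.2 • Ae)) ∧
    (LeonardTriple.IsTotallyAlmostBipartite d A As Ae →
      ∀ ξ ∈ LeonardTriple.normalizingScalars d A As Ae,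
      ∀ η ∈ LeonardTriple.normalizingScalars d A As Ae,
        ξ ≠ η →
        ¬ LeonardTriple.Isomorphic (ξ.1 • A) (ξ.2.1 • As) (ξ.2.2 • Ae)
          (η.1 • A) (η.2.1 • As) (η.2.2 • Ae)) := by
  open LeonardTriple in
  have hd3 : 3 ≤ d := by omega
  have hd1 : 1 < d + 1 := by omega
  obtain ⟨⟨v, hv⟩, ⟨w, hw⟩, ⟨u, hu⟩⟩ := hBI.1
  have hsparse : HasSparseDiagonal (LinearMap.toMatrix v v As) ∧
      HasSparseDiagonal (LinearMap.toMatrix v v Ae) ∧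
      HasSparseDiagonal (LinearMap.toMatrix w w Ae) ∧
      HasSparseDiagonal (LinearMap.toMatrix w w A) ∧
      HasSparseDiagonal (LinearMap.toMatrix u u As) := by
    rcases hBAB with ⟨-, h₁, h₂, h₃⟩ | ⟨-, h₁, h₂, h₃⟩
    · exact ⟨(h₁ v hv).1.hasSparseDiagonal, (h₁ v hv).2.hasSparseDiagonal,
        (h₂ w hw).1.hasSparseDiagonal, (h₂ w hw).2.hasSparseDiagonal,
        (h₃ u hu).2.hasSparseDiagonal⟩
    · exact ⟨(h₁ v hv).1.hasSparseDiagonal, (h₁ v hv).2.hasSparseDiagonal,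
        (h₂ w hw).1.hasSparseDiagonal, (h₂ w hw).2.hasSparseDiagonal,
        (h₃ u hu).2.hasSparseDiagonal⟩
  obtain ⟨s₁, s₂, s₃, s₄, s₅⟩ := hsparse
  obtain ⟨n₁, n₂, n₃, h₁, h₂, h₃, e₃, e₁, e₂⟩ :=
    exists_anticommutators hd3 hv hw hu s₁ s₂ s₃ s₄ s₅ hBI
  have ne_zero : ∀ {X : Module.End K V} {b : Module.Basis (Fin (d + 1)) K V},
      IsIrreducibleTridiagonal (LinearMap.toMatrix b b X) → X ≠ 0 := by
    rintro X b h rfl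
    exact (h.2 0 ⟨1, hd1⟩ (by simp)).1 (by simp)
  have hmem := mem_normalizingScalars_iff hBAB hBI (ne_zero hw.2.2) (ne_zero hv.2.1)
    (ne_zero hv.2.2) h₁ h₂ h₃ e₃ e₁ e₂
  refine ⟨?_, ?_, ?_⟩
  · rw [show normalizingScalars d A As Ae = _ from Set.ext hmem]
    exact ncard_sign_choices (div_ne_zero (OfNat.ofNat_ne_zero 4) (mul_ne_zero h₂ h₃))
      (div_ne_zero (OfNat.ofNat_ne_zero 4) (mul_ne_zero h₁ h₃))
  · rintro ⟨-, b₁, b₂, b₃⟩ ⟨x, y, z⟩ hξ ⟨x', y', z'⟩ hη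
    obtain ⟨f₁, f₂, f₃⟩ := (hmem _).mp hξ
    obtain ⟨g₁, g₂, g₃⟩ := (hmem _).mp hη
    simp only at f₁ f₂ f₃ g₁ g₂ g₃
    rw [← g₁] at f₁
    rw [← g₂] at f₂
    subst f₃ g₃
    -- The product formula for the third scalar makes the number of sign changes even: none, or all
    -- but one. In the latter cases the reflection in an eigenbasis (`v`, `w` or `u`) of the map
    -- whose scalar is unchanged is the isomorphism.
    rcases sq_eq_sq_iff_eq_or_eq_neg.mp f₁ with rfl | rfl <;>
      rcases sq_eq_sq_iff_eq_or_eq_neg.mp f₂ with rfl | rfl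
    · exact ⟨LinearEquiv.refl K V, fun _ => rfl, fun _ => rfl, fun _ => rfl⟩
    · obtain ⟨φ, hc, ha⟩ := exists_sign_equiv v
      refine ⟨φ, fun t => ?_, fun t => ?_, fun t => ?_⟩
      · simp [hc A hv.1]
      · simp [ha As (b₁ v hv).1]
      · simp [ha Ae (b₁ v hv).2, neg_div]
    · obtain ⟨φ, hc, ha⟩ := exists_sign_equiv w
      refine ⟨φ, fun t => ?_, fun t => ?_, fun t => ?_⟩
      · simp [ha A (b₂ w hw).2]
      · simp [hc As hw.1]
      · simp [ha Ae (b₂ w hw).1, neg_div]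
    · obtain ⟨φ, hc, ha⟩ := exists_sign_equiv u
      refine ⟨φ, fun t => ?_, fun t => ?_, fun t => ?_⟩
      · simp [ha A (b₃ u hu).1]
      · simp [ha As (b₃ u hu).2]
      · simp [hc Ae hu.1]
  · rintro ⟨-, b₁, b₂, -⟩ ξ - η - hne ⟨φ, hA, hAs, hAe⟩
    have scalar_eq : ∀ {X : Module.End K V} {b : Module.Basis (Fin (d + 1)) K V} {x y : K},
        IsAlmostBipartite (LinearMap.toMatrix b b X) →
        (∀ t, φ ((x • X) t) = (y • X) (φ t)) → x = y := by
      intro X b x y hX h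
      have := trace_eq_of_intertwining φ h
      rw [map_smul, map_smul] at this
      exact mul_right_cancel₀ (trace_ne_zero_of_isAlmostBipartite hX (by omega)) this
    exact hne (Prod.ext (scalar_eq (b₂ w hw).2 hA)
      (Prod.ext (scalar_eq (b₁ v hv).1 hAs) (scalar_eq (b₁ v hv).2 hAe)))
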